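/- Let $1\le k\le n$ be integers. Equip the Grassmannian of $k$-dimensional linear subspaces of $\mathbb{R}^n$ with the metric $\operatorname{Dist}(H,H')=\|P^H-P^{H'}\|$, where $P^H$ is the orthogonal projection of $\mathbb{R}^n$ onto $H$ and $\|\cdot\|$ is the operator norm. For a set $K\subset\mathbb{R}^n$ and a subspace $L\subset\mathbb{R}^n$, let $K|L$ denote the orthogonal projection of $K$ onto $L$, and let $\operatorname{vol}_d$ denote $d$-dimensional volume. Let $H$ be a local maximizer of $$F(H)=\operatorname{vol}_k\big([0,1]^n\,|\,H\big),\qquad \dim H=k,$$ and put $Q=[0,1]^n|H$. For $i\in\{1,\dots,n\}$ let $v_i$ denote the orthogonal projection of the standard basis vector $e_i$ onto $H$, and let $Q|v_i^\perp$ be the projection of $Q$ onto the orthogonal complement in $H$ of the line $\{\lambda v_i : \lambda\in\mathbb{R}\}$. Then $$\operatorname{vol}_{k-1}\big(Q\,|\,v_i^\perp\big)=|v_i|\,\operatorname{vol}_k Q\qquad\text{for all } i\in\{1,\dots,n\}.$$ -/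

import Mathlib

open MeasureTheory

/-- The cube `[0,1]^n` in Euclidean space `ℝ^n`. -/
def unitCube (n : ℕ) : Set (EuclideanSpace ℝ (Fin n)) :=
  {x | ∀ i, 0 ≤ x i ∧ x i ≤ 1}

/-- `K | H`: the orthogonal projection of a set `K` onto a subspace `H` of `ℝ^n`,
as a subset of `ℝ^n` lying in `H`. -/
def projOnto {n : ℕ} (K : Set (EuclideanSpace ℝ (Fin n)))
    (H : Submodule ℝ (EuclideanSpace ℝ (Fin n))) : Set (EuclideanSpace ℝ (Fin n)) :=
  H.starProjection '' K

/-- The `d`-dimensional volume of a subset of `ℝ^n`: the `d`-dimensional Hausdorff measure,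
normalised so that it is Lebesgue measure on every `d`-dimensional subspace. -/
noncomputable def vol {n : ℕ} (d : ℕ) (K : Set (EuclideanSpace ℝ (Fin n))) : ENNReal :=
  μHE[d] K

/-- The Grassmannian of `k`-dimensional linear subspaces of `ℝ^n`. -/
def Gr (n k : ℕ) : Type :=
  {H : Submodule ℝ (EuclideanSpace ℝ (Fin n)) // Module.finrank ℝ H = k}

/-- The metric `Dist(H, H') = ‖P^H - P^{H'}‖` on the Grassmannian, where `P^H` is the orthogonal
projection of `ℝ^n` onto `H` and `‖·‖` is the operator norm. -/
noncomputable instance grMetricSpace (n k : ℕ) : MetricSpace (Gr n k) :=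
  MetricSpace.induced
    (fun H : Gr n k =>
      (H.1.starProjection : EuclideanSpace ℝ (Fin n) →L[ℝ] EuclideanSpace ℝ (Fin n)))
    (fun _ _ h => Subtype.ext (Submodule.starProjection_inj.1 h)) inferInstance

/-- The functional `F(H) = vol_k([0,1]^n | H)` on `k`-dimensional subspaces `H` of `ℝ^n`. -/
noncomputable def cubeProjVol (n k : ℕ) (H : Gr n k) : ENNReal :=
  vol k (projOnto (unitCube n) H.1)

/-- `v_i`: the orthogonal projection of the standard basis vector `e_i` onto `H`. -/
noncomputable def frameVec {n : ℕ} (H : Submodule ℝ (EuclideanSpace ℝ (Fin n))) (i : Fin n) :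
    EuclideanSpace ℝ (Fin n) :=
  H.starProjection (EuclideanSpace.single i 1)

/-- The orthogonal complement in `H` of the line spanned by `v`. -/
noncomputable def orthIn {n : ℕ} (H : Submodule ℝ (EuclideanSpace ℝ (Fin n)))
    (v : EuclideanSpace ℝ (Fin n)) : Submodule ℝ (EuclideanSpace ℝ (Fin n)) :=
  H ⊓ (Submodule.span ℝ {v})ᗮ

open scoped Pointwise Topology

/-! Suppose `v_i ≠ 0`, let `w = v_i/|v_i|`, and let `h` be an orthonormal basis of the complement of
`v_i` in `H`. Every `h_j` is orthogonal to `e_i`, so replacing `w` by `w + t e_i` tilts `H` while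
keeping `h`. The cube is the facet `x_i = 0` swept along `e_i`; the facet looks the same to `w` and
to `w + t e_i`, and `e_i` moves only the first coordinate. Hence the projected volume is `(a + (p +
t) b) / ‖w + t e_i‖`, where `p = w_i = |v_i|`, `b` is the volume of the shadow along `v_i`, and `a`
comes from the facet (`volume_coords_rotated`). Since `‖w + t e_i‖² = 1 + 2tp + t²`, a local maximum
at `t = 0` forces `b = p (a + p b)`, which is the claim. The same argument with `p = 0` excludes
`v_i = 0`, because `b` is positive. -/

/-! ### Projections and volumes in orthonormal coordinates -/

theorem starProjection_span_orthonormal {n : ℕ} {ι : Type*} [Fintype ι]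
    {o : ι → EuclideanSpace ℝ (Fin n)} (ho : Orthonormal ℝ o) :
    (Submodule.span ℝ (Set.range o)).starProjection =
      ∑ j, InnerProductSpace.rankOne ℝ (o j) (o j) := by
  classical
  ext1 x
  have hsum : (∑ j, InnerProductSpace.rankOne ℝ (o j) (o j)) x =
      ∑ j, inner ℝ (o j) x • o j := by simp
  rw [hsum]
  refine Submodule.eq_starProjection_of_mem_orthogonal
    ?_ ?_
  · exact Submodule.sum_mem _ fun j _ =>
      Submodule.smul_mem _ _ (Submodule.subset_span (Set.mem_range_self j))
  rw [Submodule.mem_orthogonal]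
  intro u hu
  induction hu using Submodule.span_induction with
  | mem y hy =>
    obtain ⟨j, rfl⟩ := hy
    rw [inner_sub_right, ho.inner_right_fintype, sub_self]
  | zero => simp
  | add y z _ _ hy hz => rw [inner_add_left, hy, hz, add_zero]
  | smul c y _ hy => rw [inner_smul_left, hy, mul_zero]

/-- The coordinates of a vector with respect to a family of vectors. -/
noncomputable def coords {n : ℕ} {ι : Type*} (o : ι → EuclideanSpace ℝ (Fin n)) :
    EuclideanSpace ℝ (Fin n) →L[ℝ] (ι → ℝ) :=
  ContinuousLinearMap.pi fun j => innerSL ℝ (o j)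

@[simp]
theorem coords_apply {n : ℕ} {ι : Type*} (o : ι → EuclideanSpace ℝ (Fin n))
    (x : EuclideanSpace ℝ (Fin n)) (j : ι) : coords o x j = inner ℝ (o j) x := rfl

theorem vol_projOnto_span {n k : ℕ} {o : Fin k → EuclideanSpace ℝ (Fin n)}
    (ho : Orthonormal ℝ o) (K : Set (EuclideanSpace ℝ (Fin n))) :
    vol k (projOnto K (Submodule.span ℝ (Set.range o))) = volume (coords o '' K) := by
  let φ : EuclideanSpace ℝ (Fin k) →ₗᵢ[ℝ] EuclideanSpace ℝ (Fin n) :=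
    LinearMap.isometryOfOrthonormal
      ((Fintype.linearCombination ℝ o) ∘ₗ (WithLp.linearEquiv 2 ℝ (Fin k → ℝ)).toLinearMap)
      (v := (EuclideanSpace.basisFun (Fin k) ℝ).toBasis)
      (by simp)
      (by
        convert ho using 1
        ext1 j
        simp [Fintype.linearCombination_apply, Pi.single_apply])
  have hφ : ∀ y, φ y = ∑ j, y j • o j := fun y => by
    change Fintype.linearCombination ℝ o y.ofLp = _
    simp [Fintype.linearCombination_apply]
  have himg : projOnto K (Submodule.span ℝ (Set.range o)) =
      φ '' ((WithLp.toLp 2) '' (coords o '' K)) := by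
    simp only [projOnto, Set.image_image]
    refine Set.image_congr fun x _ => ?_
    rw [hφ, starProjection_span_orthonormal ho]
    simp
  rw [himg, vol, φ.isometry.euclideanHausdorffMeasure_image,
    EuclideanSpace.euclideanHausdorffMeasure_eq_volume]
  have := (PiLp.volume_preserving_toLp (Fin k)).measure_preimage_emb
    (MeasurableEquiv.toLp 2 (Fin k → ℝ)).measurableEmbedding ((WithLp.toLp 2) '' (coords o '' K))
  rw [← this, Set.preimage_image_eq _ (WithLp.toLp_injective 2)]

/-! ### Sweeping and stretching along an axis -/

theorem volume_add_Icc {A : Set ℝ} (hA : IsCompact A) (hconn : IsConnected A) {s : ℝ}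
    (hs : 0 ≤ s) : volume (A + Set.Icc 0 s) = volume A + ENNReal.ofReal s := by
  have hle := hA.sInf_mem hconn.nonempty
  have hab : sInf A ≤ sSup A := le_csSup hA.bddAbove hle
  rw [eq_Icc_of_connected_compact hconn hA, Set.Icc_add_Icc hab hs, Real.volume_Icc,
    Real.volume_Icc, ← ENNReal.ofReal_add (by linarith) hs]
  congr 1
  ring

/-- Sweeping a convex body along the first coordinate axis. -/
theorem volume_sweep {m : ℕ} {S : Set (ℝ × (Fin m → ℝ))} (hS : IsCompact S) (hc : Convex ℝ S)
    {s : ℝ} (hs : 0 ≤ s) :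
    volume (S + Set.Icc 0 s ×ˢ {0}) = volume S + ENNReal.ofReal s * volume (Prod.snd '' S) := by
  have hT : IsCompact (S + Set.Icc 0 s ×ˢ ({0} : Set (Fin m → ℝ))) :=
    hS.add (isCompact_Icc.prod isCompact_singleton)
  have hP : MeasurableSet (Prod.snd '' S) := (hS.image continuous_snd).measurableSet
  rw [Measure.volume_eq_prod, Measure.prod_apply_symm hT.measurableSet,
    Measure.prod_apply_symm hS.measurableSet, ← lintegral_indicator_const hP,
    ← lintegral_add_right _ (measurable_const.indicator hP)]
  -- By convexity each nonempty slice is an interval, lengthened by exactly `s`; empty slices stay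
  -- empty, whence the indicator of the shadow.
  refine lintegral_congr fun y => ?_
  have hslice : (fun x => (x, y)) ⁻¹' (S + Set.Icc 0 s ×ˢ ({0} : Set (Fin m → ℝ))) =
      (fun x => (x, y)) ⁻¹' S + Set.Icc 0 s := by
    ext x
    simp only [Set.mem_preimage, Set.mem_add, Set.mem_prod, Set.mem_singleton_iff, Prod.exists]
    constructor
    · rintro ⟨a, b, hab, c, d, ⟨hc, rfl⟩, h⟩
      simp only [Prod.mk_add_mk, add_zero, Prod.mk.injEq] at h
      obtain ⟨rfl, rfl⟩ := h
      exact ⟨a, hab, c, hc, rfl⟩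
    · rintro ⟨a, ha, c, hc, rfl⟩
      exact ⟨a, y, ha, c, 0, ⟨hc, rfl⟩, by simp⟩
  rw [hslice]
  by_cases hy : y ∈ Prod.snd '' S
  · rw [Set.indicator_of_mem hy]
    have hne : ((fun x => (x, y)) ⁻¹' S).Nonempty := by
      obtain ⟨⟨a, b⟩, hab, rfl⟩ := hy
      exact ⟨a, hab⟩
    have hcomp : IsCompact ((fun x : ℝ => (x, y)) ⁻¹' S) := by
      refine (hS.image continuous_fst).of_isClosed_subset
        (hS.isClosed.preimage (by fun_prop)) ?_
      intro x hx
      exact ⟨(x, y), hx, rfl⟩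
    have hconv : Convex ℝ ((fun x : ℝ => (x, y)) ⁻¹' S) := by
      intro a ha b hb α β hα hβ hαβ
      have := hc ha hb hα hβ hαβ
      simpa [← add_smul, hαβ] using this
    exact volume_add_Icc hcomp ⟨hne, hconv.isPreconnected⟩ hs
  · rw [Set.indicator_of_notMem hy]
    have : (fun x => (x, y)) ⁻¹' S = ∅ := by
      ext x
      simp only [Set.mem_preimage, Set.mem_empty_iff_false, iff_false]
      exact fun h => hy ⟨_, h, rfl⟩
    simp [this]

theorem volume_stretch {m : ℕ} {S : Set (ℝ × (Fin m → ℝ))} (hS : IsCompact S) {c : ℝ}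
    (hc : 0 < c) :
    volume ((fun q : ℝ × (Fin m → ℝ) => (c * q.1, q.2)) '' S) =
      ENNReal.ofReal c * volume S := by
  have hT : IsCompact ((fun q : ℝ × (Fin m → ℝ) => (c * q.1, q.2)) '' S) :=
    hS.image (by fun_prop)
  rw [Measure.volume_eq_prod, Measure.prod_apply_symm hT.measurableSet,
    Measure.prod_apply_symm hS.measurableSet,
    ← lintegral_const_mul _ (measurable_measure_prodMk_right hS.measurableSet)]
  refine lintegral_congr fun y => ?_
  have hslice : (fun x => (x, y)) ⁻¹' ((fun q : ℝ × (Fin m → ℝ) => (c * q.1, q.2)) '' S) =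
      c • ((fun x => (x, y)) ⁻¹' S) := by
    ext x
    simp only [Set.mem_preimage, Set.mem_image, Prod.mk.injEq, Prod.exists, Set.mem_smul_set,
      smul_eq_mul]
    constructor
    · rintro ⟨a, b, hab, rfl, rfl⟩
      exact ⟨a, hab, rfl⟩
    · rintro ⟨a, ha, rfl⟩
      exact ⟨a, y, ha, rfl, rfl⟩
  rw [hslice, Measure.addHaar_smul]
  simp [abs_of_pos hc]

/-! ### One-variable optimisation -/

/-- First order condition for a ratio of an affine function and a norm. -/
theorem eq_mul_of_affine_le_norm {a b p ε : ℝ} (ha : 0 ≤ a) (hb : 0 ≤ b) (hp : 0 ≤ p)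
    (hε : 0 < ε)
    (h : ∀ t, |t| < ε → -p ≤ t → ∃ r, r ^ 2 = 1 + 2 * t * p + t ^ 2 ∧
      a + (p + t) * b ≤ (a + p * b) * r) :
    b = p * (a + p * b) := by
  have hA : 0 ≤ a + p * b := by positivity
  set A := a + p * b with hAdef
  have key : ∀ t, |t| < ε → -p ≤ t → t * b ≤ A * (t * p + t ^ 2 / 2) := by
    intro t ht hpt
    obtain ⟨r, hr, h1⟩ := h t ht hpt
    -- The tangent bound `r ≤ (1 + r²) / 2` removes the square root.
    have h2 : r ≤ 1 + (t * p + t ^ 2 / 2) := by nlinarith [sq_nonneg (r - 1)]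
    nlinarith [mul_le_mul_of_nonneg_left h2 hA]
  refine le_antisymm ?_ ?_
  · by_contra! hlt
    set δ := b - p * A
    have hδ : 0 < δ := sub_pos.2 hlt
    -- `key` divided by `t` will give `δ ≤ A t / 2`, which `t (A + 1) ≤ δ` contradicts.
    have ht0 : 0 < min (ε / 2) (δ / (A + 1)) := by positivity
    set t := min (ε / 2) (δ / (A + 1))
    have h1 : t ≤ ε / 2 := min_le_left _ _
    have h2 : t * (A + 1) ≤ δ := (le_div_iff₀ (by positivity)).1 (min_le_right _ _)
    have h3 := key t (by rw [abs_of_pos ht0]; linarith) (by linarith)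
    have h4 : b ≤ A * (p + t / 2) := le_of_mul_le_mul_left (by linarith) ht0
    have : δ = b - p * A := rfl
    nlinarith [mul_nonneg ht0.le hA]
  -- For `p = 0` no negative `t` is allowed, but this inequality is then just `0 ≤ b`.
  · rcases hp.eq_or_lt with rfl | hp0
    · simpa using hb
    by_contra! hlt
    set δ := p * A - b
    have hδ : 0 < δ := sub_pos.2 hlt
    have ht0 : 0 < min (min (ε / 2) p) (δ / (A + 1)) := by positivity
    set t := min (min (ε / 2) p) (δ / (A + 1))
    have h1 : t ≤ ε / 2 := (min_le_left _ _).trans (min_le_left _ _)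
    have h1' : t ≤ p := (min_le_left _ _).trans (min_le_right _ _)
    have h2 : t * (A + 1) ≤ δ := (le_div_iff₀ (by positivity)).1 (min_le_right _ _)
    have h3 := key (-t) (by rw [abs_neg, abs_of_pos ht0]; linarith) (by linarith)
    have h4 : A * (p - t / 2) ≤ b := le_of_mul_le_mul_left (by linarith) ht0
    have : δ = p * A - b := rfl
    nlinarith [mul_nonneg ht0.le hA]

/-! ### The cube as a swept facet -/

theorem unitCube_eq_preimage (n : ℕ) :
    unitCube n = WithLp.ofLp ⁻¹' (Set.univ.pi fun _ => Set.Icc (0 : ℝ) 1) := by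
  ext x
  simp only [unitCube, Set.mem_ofPred_eq, Set.mem_preimage, Set.mem_univ_pi, Set.mem_Icc]

theorem isCompact_unitCube (n : ℕ) : IsCompact (unitCube n) := by
  rw [unitCube_eq_preimage]
  exact (PiLp.homeomorph 2 (fun _ : Fin n => ℝ)).isCompact_preimage.2
    (isCompact_univ_pi fun _ => isCompact_Icc)

theorem convex_unitCube (n : ℕ) : Convex ℝ (unitCube n) := by
  rw [unitCube_eq_preimage]
  exact (convex_pi fun _ _ => convex_Icc 0 1).linear_preimage
    (WithLp.linearEquiv 2 ℝ (Fin n → ℝ)).toLinearMap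

theorem interior_unitCube_nonempty (n : ℕ) : (interior (unitCube n)).Nonempty := by
  refine ⟨WithLp.toLp 2 fun _ => 1 / 2, mem_interior.2
    ⟨WithLp.ofLp ⁻¹' (Set.univ.pi fun _ => Set.Ioo (0 : ℝ) 1), ?_, ?_, ?_⟩⟩
  · rw [unitCube_eq_preimage]
    exact Set.preimage_mono (Set.pi_mono fun _ _ => Set.Ioo_subset_Icc_self)
  · exact (isOpen_set_pi Set.finite_univ fun _ _ => isOpen_Ioo).preimage
      (PiLp.continuous_ofLp 2 _)
  · simp
    norm_num

/-- The facet `x_i = 0` of the cube. -/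
def cubeFacet {n : ℕ} (i : Fin n) : Set (EuclideanSpace ℝ (Fin n)) :=
  unitCube n ∩ {x | x i = 0}

theorem isCompact_cubeFacet {n : ℕ} (i : Fin n) : IsCompact (cubeFacet i) :=
  (isCompact_unitCube n).inter_right (isClosed_eq (by fun_prop) continuous_const)

theorem convex_cubeFacet {n : ℕ} (i : Fin n) : Convex ℝ (cubeFacet i) :=
  (convex_unitCube n).inter fun x hx y hy a b _ _ _ => by
    simp only [Set.mem_ofPred_eq] at hx hy
    simp [hx, hy]

theorem unitCube_eq_cubeFacet_add {n : ℕ} (i : Fin n) :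
    unitCube n = cubeFacet i + (fun s : ℝ => s • EuclideanSpace.single i (1 : ℝ)) '' Set.Icc 0 1 := by
  ext x
  constructor
  · intro hx
    refine ⟨x - x i • EuclideanSpace.single i (1 : ℝ), ⟨fun j => ?_, ?_⟩, _, ⟨x i, hx i, rfl⟩, ?_⟩
    · by_cases hj : j = i
      · subst hj; simp
      · simpa [hj] using hx j
    · simp
    · simp
  · rintro ⟨y, ⟨hy, hyi⟩, _, ⟨s, hs, rfl⟩, rfl⟩
    intro j
    by_cases hj : j = i
    · subst hj
      simp only [Set.mem_ofPred_eq] at hyi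
      simpa [hyi] using hs
    · simpa [hj] using hy j

theorem image_unitCube {n m : ℕ} {i : Fin n} (l : EuclideanSpace ℝ (Fin n) →L[ℝ] ℝ)
    (A : EuclideanSpace ℝ (Fin n) →L[ℝ] (Fin m → ℝ))
    (hA : A (EuclideanSpace.single i 1) = 0) (hl : 0 ≤ l (EuclideanSpace.single i 1)) :
    l.prod A '' unitCube n = l.prod A '' cubeFacet i +
      Set.Icc 0 (l (EuclideanSpace.single i 1)) ×ˢ {0} := by
  rw [unitCube_eq_cubeFacet_add i, Set.image_add]
  congr 1
  rw [Set.image_image]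
  have h1 : Set.Icc 0 (l (EuclideanSpace.single i 1)) =
      (fun s : ℝ => s * l (EuclideanSpace.single i 1)) '' Set.Icc 0 1 := by
    rw [Set.image_mul_right_Icc zero_le_one hl]
    simp
  rw [h1, Set.prod_singleton, Set.image_image]
  refine Set.image_congr fun s _ => ?_
  simp [hA]

/-- As `A` kills `e_i`, the sweeping segment maps into the first axis, and facet and cube have the
same image under `A`; `volume_sweep` applies. -/
theorem volume_image_unitCube {n m : ℕ} {i : Fin n} (l : EuclideanSpace ℝ (Fin n) →L[ℝ] ℝ)
    (A : EuclideanSpace ℝ (Fin n) →L[ℝ] (Fin m → ℝ))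
    (hA : A (EuclideanSpace.single i 1) = 0) (hl : 0 ≤ l (EuclideanSpace.single i 1)) :
    volume (l.prod A '' unitCube n) = volume (l.prod A '' cubeFacet i) +
      ENNReal.ofReal (l (EuclideanSpace.single i 1)) * volume (A '' unitCube n) := by
  have hsnd : A '' unitCube n = Prod.snd '' (l.prod A '' cubeFacet i) := by
    have h0 : (fun s : ℝ => A (s • EuclideanSpace.single i (1 : ℝ))) '' Set.Icc 0 1 = {0} := by
      simp [hA]
    rw [unitCube_eq_cubeFacet_add i, Set.image_add, Set.image_image, h0, Set.image_image]
    simp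
  rw [image_unitCube l A hA hl,
    volume_sweep ((isCompact_cubeFacet i).image (l.prod A).continuous)
      ((convex_cubeFacet i).is_linear_image (l.prod A).isLinear) hl, hsnd]

theorem volume_coords_vecCons {n m : ℕ} (u : EuclideanSpace ℝ (Fin n))
    (h : Fin m → EuclideanSpace ℝ (Fin n)) (K : Set (EuclideanSpace ℝ (Fin n))) :
    volume (coords (Matrix.vecCons u h) '' K) =
      volume ((innerSL ℝ u).prod (coords h) '' K) := by
  have := (volume_preserving_piFinSuccAbove (fun _ : Fin (m + 1) => ℝ) 0).measure_preimage_equiv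
    ((innerSL ℝ u).prod (coords h) '' K)
  rw [← this]
  congr 1
  rw [← MeasurableEquiv.image_symm, Set.image_image]
  refine Set.image_congr fun x _ => ?_
  rw [MeasurableEquiv.eq_symm_apply]
  ext j
  · simp
  · rfl

theorem volume_coords_vecCons_smul {n m : ℕ} (u : EuclideanSpace ℝ (Fin n))
    (h : Fin m → EuclideanSpace ℝ (Fin n)) {K : Set (EuclideanSpace ℝ (Fin n))}
    (hK : IsCompact K) {c : ℝ} (hc : 0 < c) :
    volume (coords (Matrix.vecCons (c • u) h) '' K) =
      ENNReal.ofReal c * volume ((innerSL ℝ u).prod (coords h) '' K) := by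
  rw [volume_coords_vecCons, ← volume_stretch (hK.image (ContinuousLinearMap.continuous _)) hc,
    Set.image_image]
  congr 1
  refine Set.image_congr fun x _ => ?_
  simp

/-- Orthonormality makes `coords h` surjective, hence open, so the image has interior. -/
theorem volume_coords_unitCube_ne_zero {n m : ℕ} {h : Fin m → EuclideanSpace ℝ (Fin n)}
    (ho : Orthonormal ℝ h) : volume (coords h '' unitCube n) ≠ 0 := by
  have hsurj : Function.Surjective (coords h) := fun y => by
    refine ⟨∑ j, y j • h j, ?_⟩
    ext j
    rw [coords_apply, ho.inner_right_fintype]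
  have hopen := (coords h).isOpenMap hsurj _ (isOpen_interior (s := unitCube n))
  exact ((hopen.measure_pos volume ((interior_unitCube_nonempty n).image _)).trans_le
    (measure_mono (Set.image_mono interior_subset))).ne'

theorem volume_coords_rotated {n m : ℕ} {i : Fin n} (w : EuclideanSpace ℝ (Fin n))
    {h : Fin m → EuclideanSpace ℝ (Fin n)} (hi : ∀ j, h j i = 0) {t : ℝ} (ht : 0 ≤ w i + t)
    {c : ℝ} (hc : 0 < c) :
    volume (coords (Matrix.vecCons (c • (w + t • EuclideanSpace.single i 1)) h) '' unitCube n) =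
      ENNReal.ofReal c * (volume ((innerSL ℝ w).prod (coords h) '' cubeFacet i) +
        ENNReal.ofReal (w i + t) * volume (coords h '' unitCube n)) := by
  have hA : coords h (EuclideanSpace.single i 1) = 0 := by
    ext j
    simp [hi, EuclideanSpace.inner_single_right]
  have hl : innerSL ℝ (w + t • EuclideanSpace.single i (1 : ℝ)) (EuclideanSpace.single i 1) =
      w i + t := by
    simp [EuclideanSpace.inner_single_right]
  rw [volume_coords_vecCons_smul _ _ (isCompact_unitCube n) hc,
    volume_image_unitCube _ _ hA (hl ▸ ht), hl]
  congr 3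
  refine Set.image_congr fun x hx => ?_
  have : x i = 0 := hx.2
  simp [EuclideanSpace.inner_single_left, this]

/-! ### Tilting the subspace towards `e_i` -/

theorem exists_orthonormal_vecCons {n m : ℕ} {H : Submodule ℝ (EuclideanSpace ℝ (Fin n))}
    (hH : Module.finrank ℝ H = m + 1) {w : EuclideanSpace ℝ (Fin n)} (hw : w ∈ H)
    (hw1 : ‖w‖ = 1) :
    ∃ h : Fin m → EuclideanSpace ℝ (Fin n), Orthonormal ℝ (Matrix.vecCons w h) ∧
      Submodule.span ℝ (Set.range h) = orthIn H w ∧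
      Submodule.span ℝ (Set.range (Matrix.vecCons w h)) = H := by
  have hw0 : w ≠ 0 := by
    rintro rfl
    simp at hw1
  have hrank : Module.finrank ℝ (orthIn H w) = m := by
    have h1 := Submodule.finrank_add_inf_finrank_orthogonal
      ((Submodule.span_singleton_le_iff_mem w H).2 hw)
    rw [finrank_span_singleton hw0, inf_comm, hH] at h1
    have : orthIn H w = H ⊓ (Submodule.span ℝ {w})ᗮ := rfl
    rw [this]
    omega
  let b := (stdOrthonormalBasis ℝ (orthIn H w)).reindex (finCongr hrank)
  have hb : Orthonormal ℝ fun j => (b j : EuclideanSpace ℝ (Fin n)) :=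
    b.orthonormal.comp_linearIsometry (orthIn H w).subtypeₗᵢ
  have hcons : Orthonormal ℝ (Matrix.vecCons w fun j => (b j : EuclideanSpace ℝ (Fin n))) :=
    orthonormal_vecCons_iff.2
      ⟨hw1, fun j => Submodule.mem_orthogonal_singleton_iff_inner_right.1 (b j).2.2, hb⟩
  refine ⟨fun j => b j, hcons, ?_, ?_⟩
  · have h1 := congrArg (Submodule.map (orthIn H w).subtype) b.toBasis.span_eq
    rw [Submodule.map_span, Submodule.map_top, Submodule.range_subtype, ← Set.range_comp] at h1
    convert h1 using 3
    ext1 j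
    simp
  · refine Submodule.eq_of_le_of_finrank_eq ?_ ?_
    · rw [Submodule.span_le]
      rintro _ ⟨j, rfl⟩
      refine Fin.cases hw (fun j => ?_) j
      exact (b j).2.1
    · rw [finrank_span_eq_card hcons.linearIndependent, hH, Fintype.card_fin]

theorem norm_add_smul_single_sq {n : ℕ} {w : EuclideanSpace ℝ (Fin n)} (hw : ‖w‖ = 1)
    (i : Fin n) (t : ℝ) :
    ‖w + t • EuclideanSpace.single i (1 : ℝ)‖ ^ 2 = 1 + 2 * t * w i + t ^ 2 := by
  rw [norm_add_sq_real, hw, inner_smul_right, norm_smul, EuclideanSpace.inner_single_right]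
  simp
  ring

theorem orthonormal_rotated {n m : ℕ} {i : Fin n} {w : EuclideanSpace ℝ (Fin n)}
    {h : Fin m → EuclideanSpace ℝ (Fin n)} (ho : Orthonormal ℝ (Matrix.vecCons w h))
    (hi : ∀ j, h j i = 0) {t : ℝ} (ht : w + t • EuclideanSpace.single i (1 : ℝ) ≠ 0) :
    Orthonormal ℝ (Matrix.vecCons (‖w + t • EuclideanSpace.single i (1 : ℝ)‖⁻¹ •
      (w + t • EuclideanSpace.single i (1 : ℝ))) h) := by
  rw [orthonormal_vecCons_iff] at ho ⊢
  refine ⟨norm_smul_inv_norm (𝕜 := ℝ) ht, fun j => ?_, ho.2.2⟩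
  simp [inner_smul_left, inner_add_left, ho.2.1 j, hi j, EuclideanSpace.inner_single_left]

/-- Ensures that the tilted subspaces are close to `H` in `Dist` for small `t`; only the first
rank-one term varies. -/
theorem continuousAt_rotated_projection {n m : ℕ} (i : Fin n) {w : EuclideanSpace ℝ (Fin n)}
    (hw : ‖w‖ = 1) (h : Fin m → EuclideanSpace ℝ (Fin n)) :
    ContinuousAt (fun t : ℝ => ∑ j, InnerProductSpace.rankOne ℝ
      (Matrix.vecCons (‖w + t • EuclideanSpace.single i (1 : ℝ)‖⁻¹ •
        (w + t • EuclideanSpace.single i (1 : ℝ))) h j)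
      (Matrix.vecCons (‖w + t • EuclideanSpace.single i (1 : ℝ)‖⁻¹ •
        (w + t • EuclideanSpace.single i (1 : ℝ))) h j)) 0 := by
  have hu : ContinuousAt (fun t : ℝ => ‖w + t • EuclideanSpace.single i (1 : ℝ)‖⁻¹ •
        (w + t • EuclideanSpace.single i (1 : ℝ))) 0 := by
    have h1 : ContinuousAt (fun t : ℝ => w + t • EuclideanSpace.single i (1 : ℝ)) 0 := by
      fun_prop
    exact (h1.norm.inv₀ (by simp [hw])).smul h1
  simp only [Fin.sum_univ_succ, Matrix.cons_val_zero, Matrix.cons_val_succ]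
  refine ContinuousAt.add ?_ continuousAt_const
  exact ((InnerProductSpace.rankOne ℝ).continuous.continuousAt.comp hu).clm_apply hu

/-- Stated for any unit `w` whose complement in `H` is orthogonal to `e_i`, so that it also covers
`v_i = 0`, where `w` is arbitrary. -/
theorem volume_shadow_eq_of_isLocalMax {n m : ℕ} {i : Fin n} {w : EuclideanSpace ℝ (Fin n)}
    {h : Fin m → EuclideanSpace ℝ (Fin n)} (ho : Orthonormal ℝ (Matrix.vecCons w h))
    (hi : ∀ j, h j i = 0) (hp : 0 ≤ w i) {H : Gr n (m + 1)}
    (hspan : Submodule.span ℝ (Set.range (Matrix.vecCons w h)) = H.1)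
    (hH : IsLocalMax (cubeProjVol n (m + 1)) H) :
    volume (coords h '' unitCube n) = ENNReal.ofReal (w i) * cubeProjVol n (m + 1) H := by
  have hw : ‖w‖ = 1 := (orthonormal_vecCons_iff.1 ho).1
  obtain ⟨a, ha, haE⟩ : ∃ a : ℝ, 0 ≤ a ∧
      volume ((innerSL ℝ w).prod (coords h) '' cubeFacet i) = ENNReal.ofReal a :=
    ⟨_, ENNReal.toReal_nonneg, (ENNReal.ofReal_toReal ((isCompact_cubeFacet i).image
      (ContinuousLinearMap.continuous _)).measure_lt_top.ne).symm⟩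
  obtain ⟨b, hb, hbE⟩ : ∃ b : ℝ, 0 ≤ b ∧
      volume (coords h '' unitCube n) = ENNReal.ofReal b :=
    ⟨_, ENNReal.toReal_nonneg, (ENNReal.ofReal_toReal ((isCompact_unitCube n).image
      (ContinuousLinearMap.continuous _)).measure_lt_top.ne).symm⟩
  have hvol : ∀ t c : ℝ, 0 ≤ w i + t → 0 < c →
      volume (coords (Matrix.vecCons (c • (w + t • EuclideanSpace.single i 1)) h) ''
        unitCube n) = ENNReal.ofReal (c * (a + (w i + t) * b)) := by
    intro t c ht hc
    rw [volume_coords_rotated w hi ht hc, haE, hbE, ENNReal.ofReal_mul hc.le,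
      ENNReal.ofReal_add ha (by positivity), ENNReal.ofReal_mul ht]
  have hF : cubeProjVol n (m + 1) H = ENNReal.ofReal (a + w i * b) := by
    have := hvol 0 1 (by simpa using hp) one_pos
    rw [cubeProjVol, ← hspan, vol_projOnto_span ho]
    simpa using this
  obtain ⟨ε, hε, hmax⟩ := Metric.eventually_nhds_iff.1 hH
  have hcont := continuousAt_rotated_projection i hw h
  have hne : ∀ᶠ t : ℝ in 𝓝 0, w + t • EuclideanSpace.single i (1 : ℝ) ≠ 0 := by
    refine ContinuousAt.eventually_ne (by fun_prop) ?_
    rw [zero_smul, add_zero, ← norm_ne_zero_iff, hw]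
    exact one_ne_zero
  obtain ⟨δ, hδ, hnear⟩ := Metric.eventually_nhds_iff.1
    (hne.and (Metric.continuousAt_iff'.1 hcont ε hε))
  rw [hF, hbE, ← ENNReal.ofReal_mul hp]
  congr 1
  refine eq_mul_of_affine_le_norm ha hb hp hδ fun t ht hpt => ?_
  obtain ⟨hu, hdist⟩ := hnear (y := t) (by simpa using ht)
  have hr : 0 < ‖w + t • EuclideanSpace.single i (1 : ℝ)‖ := norm_pos_iff.2 hu
  have hot := orthonormal_rotated ho hi hu
  refine ⟨_, norm_add_smul_single_sq hw i t, ?_⟩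
  let H' : Gr n (m + 1) :=
    ⟨_, (finrank_span_eq_card hot.linearIndependent).trans (Fintype.card_fin _)⟩
  have hle : cubeProjVol n (m + 1) H' ≤ cubeProjVol n (m + 1) H := by
    refine hmax ?_
    change dist H'.1.starProjection H.1.starProjection < ε
    rw [← hspan, starProjection_span_orthonormal hot, starProjection_span_orthonormal ho]
    simpa [hw] using hdist
  rw [hF, cubeProjVol, vol_projOnto_span hot, hvol t _ (by linarith) (inv_pos.2 hr),
    ENNReal.ofReal_le_ofReal_iff (by positivity), inv_mul_le_iff₀ hr, mul_comm ‖_‖] at hle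
  exact hle

/-! ### The vectors `v_i` and the conclusion -/

theorem projOnto_projOnto_orthIn {n : ℕ} (H : Submodule ℝ (EuclideanSpace ℝ (Fin n)))
    (v : EuclideanSpace ℝ (Fin n)) (K : Set (EuclideanSpace ℝ (Fin n))) :
    projOnto (projOnto K H) (orthIn H v) = projOnto K (orthIn H v) := by
  simp only [projOnto, Set.image_image]
  refine Set.image_congr fun x _ => ?_
  exact DFunLike.congr_fun (Submodule.starProjection_comp_starProjection_of_le
    (inf_le_left : orthIn H v ≤ H)) x

theorem inner_frameVec {n : ℕ} {H : Submodule ℝ (EuclideanSpace ℝ (Fin n))} (i : Fin n)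
    {x : EuclideanSpace ℝ (Fin n)} (hx : x ∈ H) : inner ℝ (frameVec H i) x = x i := by
  rw [frameVec, Submodule.inner_starProjection_left_eq_right,
    Submodule.starProjection_eq_self_iff.2 hx, EuclideanSpace.inner_single_left]
  simp

theorem frameVec_mem {n : ℕ} (H : Submodule ℝ (EuclideanSpace ℝ (Fin n))) (i : Fin n) :
    frameVec H i ∈ H := Submodule.starProjection_apply_mem _ _

/-- If `v_i = 0`, all of `H` is orthogonal to `e_i`; the first order condition with `p = 0` then
gives a shadow of volume zero, which is impossible. -/
theorem frameVec_ne_zero_of_isLocalMax {n m : ℕ} {H : Gr n (m + 1)}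
    (hH : IsLocalMax (cubeProjVol n (m + 1)) H) (i : Fin n) : frameVec H.1 i ≠ 0 := by
  intro hv
  have hzero : ∀ x ∈ H.1, x i = 0 := fun x hx => by
    rw [← inner_frameVec i hx, hv, inner_zero_left]
  have hrank : Module.finrank ℝ H.1 = m + 1 := H.2
  have : Nontrivial H.1 := Module.nontrivial_of_finrank_pos (R := ℝ) (by omega)
  obtain ⟨⟨w, hwH⟩, hw⟩ := exists_norm_eq H.1 zero_le_one
  obtain ⟨h, ho, -, hspan⟩ := exists_orthonormal_vecCons hrank hwH hw
  have hi : ∀ j, h j i = 0 := fun j => hzero _ (by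
    rw [← hspan]
    exact Submodule.subset_span ⟨j.succ, rfl⟩)
  have h1 := volume_shadow_eq_of_isLocalMax ho hi (hzero w hwH).ge hspan hH
  rw [hzero w hwH, ENNReal.ofReal_zero, zero_mul] at h1
  exact volume_coords_unitCube_ne_zero (orthonormal_vecCons_iff.1 ho).2.2 h1

theorem orthIn_smul {n : ℕ} (H : Submodule ℝ (EuclideanSpace ℝ (Fin n)))
    (v : EuclideanSpace ℝ (Fin n)) {c : ℝ} (hc : c ≠ 0) : orthIn H (c • v) = orthIn H v := by
  rw [orthIn, orthIn, Submodule.span_singleton_smul_eq hc.isUnit]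

theorem corollary1 (n k : ℕ) (hk : 1 ≤ k) (H : Gr n k)
    (hH : IsLocalMax (cubeProjVol n k) H) (i : Fin n) :
    vol (k - 1) (projOnto (projOnto (unitCube n) H.1) (orthIn H.1 (frameVec H.1 i))) =
      ENNReal.ofReal ‖frameVec H.1 i‖ * vol k (projOnto (unitCube n) H.1) := by
  obtain ⟨m, rfl⟩ := Nat.exists_eq_add_of_le' hk
  have hv := frameVec_ne_zero_of_isLocalMax hH i
  set v := frameVec H.1 i with hvdef
  have hvH : v ∈ H.1 := frameVec_mem H.1 i
  have hwi : (‖v‖⁻¹ • v) i = ‖v‖ := by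
    have h1 : v i = ‖v‖ ^ 2 := by
      rw [← inner_frameVec i hvH, ← hvdef, real_inner_self_eq_norm_sq]
    have h2 : ‖v‖ ≠ 0 := norm_ne_zero_iff.2 hv
    rw [PiLp.smul_apply, h1, smul_eq_mul]
    field_simp
  obtain ⟨h, ho, hspan0, hspan⟩ := exists_orthonormal_vecCons H.2
    (Submodule.smul_mem _ ‖v‖⁻¹ hvH) (norm_smul_inv_norm (𝕜 := ℝ) hv)
  rw [orthIn_smul _ _ (inv_ne_zero (norm_ne_zero_iff.2 hv))] at hspan0
  -- On `H` the `i`-th coordinate is the inner product with `v_i`.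
  have hi : ∀ j, h j i = 0 := fun j => by
    have hj : h j ∈ orthIn H.1 v := hspan0 ▸ Submodule.subset_span ⟨j, rfl⟩
    rw [← inner_frameVec i hj.1]
    exact Submodule.mem_orthogonal_singleton_iff_inner_right.1 hj.2
  have h1 := volume_shadow_eq_of_isLocalMax ho hi ((norm_nonneg v).trans_eq hwi.symm) hspan hH
  rw [hwi] at h1
  rw [projOnto_projOnto_orthIn, ← hspan0, Nat.add_sub_cancel,
    vol_projOnto_span (orthonormal_vecCons_iff.1 ho).2.2, h1]
  rfl
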